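/- Let $n \ge 2$ and let $s$ be the common order of the weights. A weighted graph on $\{1,\dots,n\}$ is a simple undirected graph, each edge $(i,j)$ of which carries a real symmetric positive definite $s\times s$ matrix $W_{ij}=W_{ji}$ as weight. Let $T$ be a weighted tree on $\{1,\dots,n\}$, and let $D=[D_{ij}]$ be its distance matrix: the $ns\times ns$ block matrix whose block $D_{ij}$ is the sum of the weights of the edges on the path joining $i$ and $j$ in $T$, with $D_{ii}=0$. Let $G$ be any connected weighted graph on $\{1,\dots,n\}$, with weights of order $s$ as well, and let $L=[L_{ij}]$ be its Laplacian: $L_{ij}=-W_{ij}^{-1}$ if $i\neq j$ are adjacent in $G$, $L_{ij}=0$ if $i\ne j$ are not adjacent, and $L_{ii}$ is the sum of $W_{ik}^{-1}$ over the neighbours $k$ of $i$, where the $W_{ij}$ are now the weights of $G$. Let $U$ be the $ns\times s$ matrix $(I_s,\dots,I_s)'$, and let $J$ be the $ns\times ns$ block matrix with each block equal to $I_s$. Write the inertia of a symmetric matrix $A$ as $\mathrm{In}(A)=(n_-(A),n_z(A),n_+(A))$, where $n_-(A)$ and $n_+(A)$ are the numbers of negative and positive eigenvalues counted with multiplicity,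 and $n_z(A)$ is the nullity. Then $D$ is nonsingular, and for every real $\beta\ge 0$ the following hold. (i) $D^{-1}-\beta L$ is nonsingular. (ii) $D^{-1}-\beta L$ is symmetric and $\mathrm{In}(D^{-1}-\beta L)=(ns-s,0,s)$. (iii) For every $i\in\{1,\dots,n\}$, the principal block submatrix of $D^{-1}-\beta L$ obtained by deleting the $i$-th block row and block column is negative definite if $\beta>0$, and negative semidefinite if $\beta=0$. (iv) The bordered matrix $\begin{pmatrix}(D^{-1}-\beta L)^{-1} & U\\ U' & 0\end{pmatrix}$ is nonsingular and has exactly $s$ positive eigenvalues, counted with multiplicity. (v) $(D^{-1}-\beta L)^{-1}$ is negative semidefinite on the null space of $J$: $x'(D^{-1}-\beta L)^{-1}x\le 0$ for all $x\in\mathbb{R}^{ns}$ with $Jx=0$. (vi) Every $s\times s$ block $B$ of $(D^{-1}-L)^{-1}$ is positive definite, in the sense that $x'Bx>0$ for all nonzero $x\in\mathbb{R}^s$ (the off-diagonal blocks need not be symmetric). -/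

import Mathlib

open scoped Matrix

/-- A weighted graph on the vertices `0, …, n - 1`: a finite simple undirected graph, each edge of
which carries a (symmetric) positive definite real matrix of order `s`. The values of `weight` on
pairs that are not edges are never used. -/
structure WeightedGraph (n s : ℕ) where
  graph : SimpleGraph (Fin n)
  weight : Sym2 (Fin n) → Matrix (Fin s) (Fin s) ℝ
  weight_posDef : ∀ e ∈ graph.edgeSet, (weight e).PosDef

/-- The `ns × ns` matrix whose `(i, j)` block is the `s × s` matrix `B i j`. -/
def ofBlocks {n s : ℕ} (B : Fin n → Fin n → Matrix (Fin s) (Fin s) ℝ) :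
    Matrix (Fin n × Fin s) (Fin n × Fin s) ℝ :=
  Matrix.of fun p q => B p.1 q.1 p.2 q.2

/-- The `(i, j)` block of an `ns × ns` block matrix. -/
def blockAt {n s : ℕ} (A : Matrix (Fin n × Fin s) (Fin n × Fin s) ℝ) (i j : Fin n) :
    Matrix (Fin s) (Fin s) ℝ :=
  Matrix.of fun a b => A (i, a) (j, b)

/-- The principal block submatrix of `A` on the block rows and block columns in `Δ`. -/
def principalBlocks {n s : ℕ} (A : Matrix (Fin n × Fin s) (Fin n × Fin s) ℝ)
    (Δ : Finset (Fin n)) : Matrix (Δ × Fin s) (Δ × Fin s) ℝ :=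
  Matrix.of fun p q => A (p.1, p.2) (q.1, q.2)

namespace WeightedGraph

variable {n s : ℕ} (G : WeightedGraph n s)

open Classical in
/-- The inverse of the weight of the edge `{i, j}`; the null matrix if `i, j` are not adjacent. -/
noncomputable def invWeight (i j : Fin n) : Matrix (Fin s) (Fin s) ℝ :=
  if G.graph.Adj i j then (G.weight s(i, j))⁻¹ else 0

/-- The block Laplacian. -/
noncomputable def laplacian : Matrix (Fin n × Fin s) (Fin n × Fin s) ℝ :=
  ofBlocks fun i j => if i = j then ∑ k, G.invWeight i k else -G.invWeight i j

/-- The sum of the weights of the edges of a walk. -/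
def walkWeight {i j : Fin n} (p : G.graph.Walk i j) : Matrix (Fin s) (Fin s) ℝ :=
  (p.edges.map G.weight).sum

/-- The distance between two vertices of a weighted tree: the sum of the weights lying in the
path that connects them, and the null matrix if the vertices coincide. -/
noncomputable def treeDist (hG : G.graph.IsTree) (i j : Fin n) : Matrix (Fin s) (Fin s) ℝ :=
  if i = j then 0 else G.walkWeight (hG.existsUnique_path i j).choose

/-- The block distance matrix of a weighted tree. -/
noncomputable def distMatrix (hG : G.graph.IsTree) :
    Matrix (Fin n × Fin s) (Fin n × Fin s) ℝ :=
  ofBlocks (G.treeDist hG)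

theorem treeDist_eq_walkWeight (hG : G.graph.IsTree) {i j : Fin n} (p : G.graph.Walk i j)
    (hp : p.IsPath) : G.treeDist hG i j = G.walkWeight p := by
  have h := (hG.existsUnique_path i j).choose_spec
  have hpe : p = (hG.existsUnique_path i j).choose := h.2 p hp
  unfold treeDist
  split_ifs with hij
  · subst hij
    have : p = SimpleGraph.Walk.nil := (SimpleGraph.Walk.isPath_iff_nil.1 hp).eq_nil
    simp [this, walkWeight]
  · rw [← hpe]

end WeightedGraph

/-- The `ns × s` matrix `U = e ⊗ I_s`, a column of `n` identity matrices. -/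
def blockOnes (n s : ℕ) : Matrix (Fin n × Fin s) (Fin s) ℝ :=
  Matrix.of fun p b => (1 : Matrix (Fin s) (Fin s) ℝ) p.2 b

/-- The `ns × ns` matrix `J`, each block of which is the identity `I_s`. -/
def blockJ (n s : ℕ) : Matrix (Fin n × Fin s) (Fin n × Fin s) ℝ :=
  ofBlocks fun _ _ => 1

/-- The number of negative eigenvalues, with multiplicity (used for symmetric matrices). -/
noncomputable def numNegEigenvalues {m : Type*} [Fintype m] [DecidableEq m]
    (A : Matrix m m ℝ) : ℕ :=
  A.charpoly.roots.countP fun x => x < 0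

/-- The number of positive eigenvalues, with multiplicity (used for symmetric matrices). -/
noncomputable def numPosEigenvalues {m : Type*} [Fintype m] [DecidableEq m]
    (A : Matrix m m ℝ) : ℕ :=
  A.charpoly.roots.countP fun x => 0 < x

/-- The nullity of a square matrix. -/
noncomputable def nullity {m : Type*} [Fintype m] [DecidableEq m] (A : Matrix m m ℝ) : ℕ :=
  Module.finrank ℝ (LinearMap.ker (Matrix.toLin' A))

/-- The inertia `(n₋, n_z, n₊)` of a symmetric matrix. -/
noncomputable def inertia {m : Type*} [Fintype m] [DecidableEq m] (A : Matrix m m ℝ) :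
    ℕ × ℕ × ℕ :=
  (numNegEigenvalues A, nullity A, numPosEigenvalues A)

/-- Positive definiteness of the quadratic form `x ↦ x' A x`, for a square matrix that need not be
symmetric. For symmetric matrices this is `Matrix.PosDef`; the off-diagonal blocks of a symmetric
block matrix are not symmetric in general. -/
def IsPosDefForm {m : Type*} [Fintype m] (A : Matrix m m ℝ) : Prop :=
  ∀ x : m → ℝ, x ≠ 0 → 0 < x ⬝ᵥ (A *ᵥ x)

/-!
The Laplacian `L_T` and the distance matrix `D` of the tree `T` satisfy
`L_T D = τ U' - 2 I`. On the null space of `U'` this reads `L_T D z = -2 z`, so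
`z' D z = -(D z)' L_T (D z) / 2 < 0` for `z ≠ 0`: the form of `D` is negative definite on a subspace
of codimension `s`. It is positive on suitable lifts of the nonzero vectors of `ℝˢ` along `U'`, so
`D` is nonsingular and `U' D⁻¹ U` is positive definite. Let `A = D⁻¹ - P` with `P` positive
semidefinite and `P U = 0`, in particular `P = β L`. Then `A` is positive definite on the range of
`U` and negative definite on the image under `D` of the null space of `U'`, which fixes its inertia;
the bordered matrix has Schur complement `-U' A U`.

The diagonal blocks of `D` vanish, so `D⁻¹` is nonpositive on the vectors with a vanishing block,
and subtracting `β L` makes the form strictly negative there when `β > 0`, since the null space of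
`L` consists of the vectors with equal blocks. This makes the diagonal blocks of `A⁻¹` positive
definite. For the others, `A⁻¹` is nonpositive on the null space of `U'`; at the vector with `x` in
block `i` and `-x` in block `j` this gives
`2 x' (A⁻¹)ᵢⱼ x ≥ x' (A⁻¹)ᵢᵢ x + x' (A⁻¹)ⱼⱼ x > 0`.
-/

section Inertia

variable {m k : Type*} [Fintype m] [Fintype k]

theorem dotProduct_transpose_mul_mul_mulVec (A : Matrix m m ℝ) (S : Matrix m k ℝ) (x y : k → ℝ) :
    x ⬝ᵥ (Sᵀ * A * S) *ᵥ y = (S *ᵥ x) ⬝ᵥ A *ᵥ (S *ᵥ y) := by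
  rw [Matrix.mul_assoc, ← Matrix.mulVec_mulVec, ← Matrix.mulVec_mulVec,
    Matrix.dotProduct_transpose_mulVec, dotProduct_comm]

theorem dotProduct_mulVec_comm {A : Matrix m m ℝ} (hA : A.IsHermitian) (x y : m → ℝ) :
    x ⬝ᵥ A *ᵥ y = y ⬝ᵥ A *ᵥ x := by
  rw [← Matrix.dotProduct_transpose_mulVec, (Matrix.isHermitian_iff_isSymm.1 hA).eq]

variable [DecidableEq m] {A : Matrix m m ℝ}

theorem mulVec_inv_mulVec (hu : IsUnit A) (x : m → ℝ) : A *ᵥ A⁻¹ *ᵥ x = x := by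
  rw [Matrix.mulVec_mulVec, Matrix.mul_nonsing_inv _ ((Matrix.isUnit_iff_isUnit_det _).1 hu),
    Matrix.one_mulVec]

theorem inv_mulVec_mulVec (hu : IsUnit A) (x : m → ℝ) : A⁻¹ *ᵥ A *ᵥ x = x := by
  rw [Matrix.mulVec_mulVec, Matrix.nonsing_inv_mul _ ((Matrix.isUnit_iff_isUnit_det _).1 hu),
    Matrix.one_mulVec]

theorem toQuadraticForm'_apply (A : Matrix m m ℝ) (x : m → ℝ) :
    A.toQuadraticForm' x = x ⬝ᵥ A *ᵥ x := by
  simp [Matrix.toQuadraticForm', Matrix.toLinearMap₂'_apply']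

theorem equivalent_toQuadraticForm'_congruence (A : Matrix m m ℝ) {S : Matrix m m ℝ}
    (hS : IsUnit S) :
    (Sᵀ * A * S).toQuadraticForm'.Equivalent A.toQuadraticForm' :=
  ⟨{ LinearEquiv.ofBijective S.mulVecLin
      ⟨Matrix.mulVec_injective_of_isUnit hS, Matrix.mulVec_surjective_iff_isUnit.2 hS⟩ with
    map_app' := fun x => by
      rw [toQuadraticForm'_apply, toQuadraticForm'_apply, dotProduct_transpose_mul_mul_mulVec]
      rfl }⟩

theorem equivalent_toQuadraticForm'_weightedSumSquares (hA : A.IsHermitian) :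
    A.toQuadraticForm'.Equivalent (QuadraticMap.weightedSumSquares ℝ hA.eigenvalues) := by
  let V : Matrix m m ℝ := hA.eigenvectorUnitary
  have hspec : A = Vᵀᵀ * Matrix.diagonal hA.eigenvalues * Vᵀ := by
    conv_lhs => rw [hA.spectral_theorem, Unitary.conjStarAlgAut_apply]
    simp [V, Matrix.star_eq_conjTranspose]
  have hV : IsUnit Vᵀ := V.isUnit_transpose.2 (Unitary.toUnits hA.eigenvectorUnitary).isUnit
  have hdiag : (Matrix.diagonal hA.eigenvalues).toQuadraticForm' =
      QuadraticMap.weightedSumSquares ℝ hA.eigenvalues := by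
    ext x
    rw [toQuadraticForm'_apply]
    simp [dotProduct, Matrix.mulVec_diagonal, QuadraticMap.weightedSumSquares_apply, mul_left_comm]
  have h := equivalent_toQuadraticForm'_congruence (Matrix.diagonal hA.eigenvalues) hV
  rwa [← hspec, hdiag] at h

theorem countP_roots_charpoly (hA : A.IsHermitian) (p : ℝ → Prop) [DecidablePred p] :
    A.charpoly.roots.countP p = {i | p (hA.eigenvalues i)}.ncard := by
  rw [hA.roots_charpoly_eq_eigenvalues, Multiset.countP_map, Set.ncard_eq_toFinset_card']
  simp [Finset.card]

theorem numPosEigenvalues_eq_sigPos (hA : A.IsHermitian) :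
    numPosEigenvalues A = sigPos A.toQuadraticForm' := by
  rw [QuadraticForm.sigPos_of_equiv_weightedSumSquares
    (equivalent_toQuadraticForm'_weightedSumSquares hA), ← countP_roots_charpoly hA (0 < ·),
    numPosEigenvalues]

theorem numNegEigenvalues_eq_sigNeg (hA : A.IsHermitian) :
    numNegEigenvalues A = sigNeg A.toQuadraticForm' := by
  rw [QuadraticForm.sigNeg_of_equiv_weightedSumSquares
    (equivalent_toQuadraticForm'_weightedSumSquares hA), ← countP_roots_charpoly hA (· < 0),
    numNegEigenvalues]

/-- Sylvester's law of inertia. -/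
theorem numPosEigenvalues_congruence (hA : A.IsHermitian) {S : Matrix m m ℝ} (hS : IsUnit S) :
    numPosEigenvalues (Sᵀ * A * S) = numPosEigenvalues A := by
  have hSA : (Sᵀ * A * S).IsHermitian := by
    simpa using Matrix.isHermitian_conjTranspose_mul_mul S hA
  rw [numPosEigenvalues_eq_sigPos hSA, numPosEigenvalues_eq_sigPos hA,
    (equivalent_toQuadraticForm'_congruence A hS).sigPos_eq]

theorem numPosEigenvalues_inv (hA : A.IsHermitian) (hu : IsUnit A) :
    numPosEigenvalues A⁻¹ = numPosEigenvalues A := by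
  have h : (A⁻¹)ᵀ * A * A⁻¹ = A⁻¹ := by
    rw [Matrix.transpose_nonsing_inv, (Matrix.isHermitian_iff_isSymm.1 hA).eq,
      Matrix.nonsing_inv_mul _ ((Matrix.isUnit_iff_isUnit_det _).1 hu), one_mul]
  rw [← numPosEigenvalues_congruence hA (Matrix.isUnit_nonsing_inv_iff.2 hu), h]

variable [DecidableEq k]

theorem numPosEigenvalues_fromBlocks_zero (A : Matrix m m ℝ) (D : Matrix k k ℝ) :
    numPosEigenvalues (Matrix.fromBlocks A 0 0 D) =
      numPosEigenvalues A + numPosEigenvalues D := by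
  rw [numPosEigenvalues, Matrix.charpoly_fromBlocks_zero₁₂, Polynomial.roots_mul
    (mul_ne_zero A.charpoly_monic.ne_zero D.charpoly_monic.ne_zero), Multiset.countP_add]
  rfl

/-- Haynsworth's inertia additivity formula. -/
theorem numPosEigenvalues_fromBlocks (hA : A.IsHermitian) (hu : IsUnit A) (B : Matrix m k ℝ)
    {D : Matrix k k ℝ} (hD : D.IsHermitian) :
    numPosEigenvalues (Matrix.fromBlocks A B Bᵀ D) =
      numPosEigenvalues A + numPosEigenvalues (D - Bᵀ * A⁻¹ * B) := by
  have := hu.invertible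
  let S : Matrix (m ⊕ k) (m ⊕ k) ℝ := Matrix.fromBlocks 1 (A⁻¹ * B) 0 1
  have hS : IsUnit S := by simp [S, Matrix.isUnit_iff_isUnit_det]
  have hAt : (A⁻¹)ᵀ = A⁻¹ := by
    rw [Matrix.transpose_nonsing_inv, (Matrix.isHermitian_iff_isSymm.1 hA).eq]
  have hLDU : Matrix.fromBlocks A B Bᵀ D =
      Sᵀ * Matrix.fromBlocks A 0 0 (D - Bᵀ * A⁻¹ * B) * S := by
    rw [Matrix.fromBlocks_eq_of_invertible₁₁]
    simp [S, Matrix.fromBlocks_transpose, hAt]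
  have hdiag : (Matrix.fromBlocks A 0 0 (D - Bᵀ * A⁻¹ * B)).IsHermitian := by
    refine hA.fromBlocks (by simp) (hD.sub ?_)
    simpa using Matrix.isHermitian_conjTranspose_mul_mul B hA.inv
  rw [hLDU, numPosEigenvalues_congruence hdiag hS, numPosEigenvalues_fromBlocks_zero]

theorem numNegEigenvalues_add_nullity_add_numPosEigenvalues (hA : A.IsHermitian) :
    numNegEigenvalues A + nullity A + numPosEigenvalues A = Fintype.card m := by
  have hdisj : Disjoint {i | hA.eigenvalues i < 0} {i | 0 < hA.eigenvalues i} :=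
    Set.disjoint_left.2 fun _ hneg => not_lt_of_gt (Set.mem_ofPred.1 hneg)
  have hrank : A.rank = numNegEigenvalues A + numPosEigenvalues A := by
    rw [hA.rank_eq_card_non_zero_eigs, numNegEigenvalues, numPosEigenvalues,
      countP_roots_charpoly hA, countP_roots_charpoly hA, ← Set.ncard_union_eq hdisj,
      ← Set.ofPred_or, ← Nat.card_eq_fintype_card]
    simp only [lt_or_lt_iff_ne]
    rfl
  have hnull : A.rank + nullity A = Fintype.card m := by
    rw [← Module.finrank_fintype_fun_eq_card ℝ (η := m)]
    exact A.toLin'.finrank_range_add_finrank_ker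
  omega

section Definite

variable {V W : Type*} [AddCommGroup V] [Module ℝ V] [AddCommGroup W] [Module ℝ W]

theorem finrank_le_sigPos {M : Type*} [AddCommGroup M] [Module ℝ M] [FiniteDimensional ℝ M]
    (Q : QuadraticForm ℝ M) (f : V →ₗ[ℝ] M) (hf : ∀ v ≠ 0, 0 < Q (f v)) :
    Module.finrank ℝ V ≤ sigPos Q := by
  have hinj : Function.Injective f := (injective_iff_map_eq_zero f).2 fun v hv => by
    by_contra hv0
    simpa [hv] using hf v hv0
  rw [← LinearMap.finrank_range_of_inj hinj]
  refine le_sigPos_of_posDef Q ?_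
  rintro ⟨_, v, rfl⟩ hv
  exact hf v fun h => hv (by simp [h])

theorem finrank_le_numPosEigenvalues (hA : A.IsHermitian) (f : V →ₗ[ℝ] m → ℝ)
    (hf : ∀ v ≠ 0, 0 < f v ⬝ᵥ A *ᵥ f v) : Module.finrank ℝ V ≤ numPosEigenvalues A := by
  rw [numPosEigenvalues_eq_sigPos hA]
  exact finrank_le_sigPos _ f fun v hv => by simpa only [toQuadraticForm'_apply] using hf v hv

theorem finrank_le_numNegEigenvalues (hA : A.IsHermitian) (f : V →ₗ[ℝ] m → ℝ)
    (hf : ∀ v ≠ 0, f v ⬝ᵥ A *ᵥ f v < 0) : Module.finrank ℝ V ≤ numNegEigenvalues A := by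
  rw [numNegEigenvalues_eq_sigNeg hA, ← sigPos_neg]
  exact finrank_le_sigPos _ f fun v hv => by
    simpa [toQuadraticForm'_apply] using hf v hv

theorem numPosEigenvalues_neg_eq_zero (hA : A.PosDef) : numPosEigenvalues (-A) = 0 := by
  have hsum := numNegEigenvalues_add_nullity_add_numPosEigenvalues hA.isHermitian.neg
  have hneg := finrank_le_numNegEigenvalues hA.isHermitian.neg LinearMap.id fun x hx => by
    simpa [Matrix.neg_mulVec] using hA.dotProduct_mulVec_pos hx
  rw [Module.finrank_fintype_fun_eq_card] at hneg
  omega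

theorem inertia_eq_of_posDef_of_negDef (hA : A.IsHermitian)
    (f : V →ₗ[ℝ] m → ℝ) (hf : ∀ v ≠ 0, 0 < f v ⬝ᵥ A *ᵥ f v)
    (g : W →ₗ[ℝ] m → ℝ) (hg : ∀ w ≠ 0, g w ⬝ᵥ A *ᵥ g w < 0)
    (hVW : Fintype.card m ≤ Module.finrank ℝ V + Module.finrank ℝ W) :
    inertia A = (Fintype.card m - Module.finrank ℝ V, 0, Module.finrank ℝ V) := by
  have hsum := numNegEigenvalues_add_nullity_add_numPosEigenvalues hA
  have hpos := finrank_le_numPosEigenvalues hA f hf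
  have hneg := finrank_le_numNegEigenvalues hA g hg
  simp only [inertia, Prod.mk.injEq]
  omega

end Definite

theorem isUnit_of_nullity_eq_zero (h : nullity A = 0) : IsUnit A := by
  rw [← Matrix.mulVec_injective_iff_isUnit]
  rw [nullity, Submodule.finrank_eq_zero, LinearMap.ker_eq_bot] at h
  exact h

end Inertia

section Bordered

variable {m k : Type*} [Fintype m] [Fintype k]

variable [DecidableEq m] {A : Matrix m m ℝ} {U : Matrix m k ℝ}

theorem dotProduct_mulVec_self_nonpos_of_posDef (hA : A.IsHermitian) (hU : (Uᵀ * A * U).PosDef)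
    (hcard : numPosEigenvalues A ≤ Fintype.card k) {w : m → ℝ} (hw : Uᵀ *ᵥ A *ᵥ w = 0) :
    w ⬝ᵥ A *ᵥ w ≤ 0 := by
  by_contra! hpos
  let f : (k → ℝ) × ℝ →ₗ[ℝ] m → ℝ := U.mulVecLin.coprod (LinearMap.toSpanSingleton ℝ _ w)
  have hform : ∀ v, f v ⬝ᵥ A *ᵥ f v =
      v.1 ⬝ᵥ (Uᵀ * A * U) *ᵥ v.1 + v.2 ^ 2 * (w ⬝ᵥ A *ᵥ w) := fun ⟨y, t⟩ => by
    have hcross : (U *ᵥ y) ⬝ᵥ A *ᵥ w = 0 := by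
      rw [dotProduct_comm, ← Matrix.dotProduct_transpose_mulVec, hw, dotProduct_zero]
    have hcross' : w ⬝ᵥ A *ᵥ (U *ᵥ y) = 0 := by
      rw [dotProduct_mulVec_comm hA, hcross]
    rw [dotProduct_transpose_mul_mul_mulVec]
    simp only [f, LinearMap.coprod_apply, Matrix.mulVecBilin_apply,
      LinearMap.toSpanSingleton_apply, Matrix.mulVec_add, Matrix.mulVec_smul, dotProduct_add,
      add_dotProduct, smul_dotProduct, dotProduct_smul, hcross, hcross', smul_eq_mul]
    ring
  have hf : ∀ v ≠ 0, 0 < f v ⬝ᵥ A *ᵥ f v := fun v hv => by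
    rw [hform]
    by_cases h1 : v.1 = 0
    · have h2 : v.2 ≠ 0 := fun h2 => hv (Prod.ext h1 h2)
      rw [h1, zero_dotProduct, zero_add]
      positivity
    · have := hU.dotProduct_mulVec_pos h1
      rw [star_trivial] at this
      positivity
  have hle := finrank_le_numPosEigenvalues hA f hf
  rw [Module.finrank_prod, Module.finrank_fintype_fun_eq_card, Module.finrank_self] at hle
  omega

theorem dotProduct_inv_mulVec_nonpos (hA : A.IsHermitian) (hu : IsUnit A)
    (hU : (Uᵀ * A * U).PosDef) (hcard : numPosEigenvalues A ≤ Fintype.card k) {x : m → ℝ}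
    (hx : Uᵀ *ᵥ x = 0) : x ⬝ᵥ A⁻¹ *ᵥ x ≤ 0 := by
  have h := dotProduct_mulVec_self_nonpos_of_posDef hA hU hcard (w := A⁻¹ *ᵥ x)
    (by rw [mulVec_inv_mulVec hu, hx])
  rwa [mulVec_inv_mulVec hu, dotProduct_comm] at h

variable [DecidableEq k]

theorem numPosEigenvalues_bordered (hA : A.IsHermitian) (hu : IsUnit A)
    (hU : (Uᵀ * A * U).PosDef) :
    numPosEigenvalues (Matrix.fromBlocks A⁻¹ U Uᵀ 0) = numPosEigenvalues A := by
  rw [numPosEigenvalues_fromBlocks hA.inv (Matrix.isUnit_nonsing_inv_iff.2 hu) U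
    Matrix.isHermitian_zero,
    Matrix.nonsing_inv_nonsing_inv _ ((Matrix.isUnit_iff_isUnit_det _).1 hu),
    numPosEigenvalues_inv hA hu, zero_sub, numPosEigenvalues_neg_eq_zero hU, add_zero]

theorem isUnit_bordered (hu : IsUnit A) (hU : IsUnit (Uᵀ * A * U)) :
    IsUnit (Matrix.fromBlocks A⁻¹ U Uᵀ 0) := by
  have := (Matrix.isUnit_nonsing_inv_iff.2 hu).invertible
  rw [Matrix.isUnit_fromBlocks_iff_of_invertible₁₁, Matrix.invOf_eq_nonsing_inv,
    Matrix.nonsing_inv_nonsing_inv _ ((Matrix.isUnit_iff_isUnit_det _).1 hu), zero_sub,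
    IsUnit.neg_iff]
  exact hU

end Bordered

section NegDefOnKer

variable {m k : Type*} [Fintype m]

/-- Negative definiteness of the quadratic form `x ↦ x' A x` on the null space of `B`, for a square
matrix `A` that need not be symmetric. -/
def IsNegDefOnKer (A : Matrix m m ℝ) (B : Matrix k m ℝ) : Prop :=
  ∀ x : m → ℝ, x ≠ 0 → B *ᵥ x = 0 → x ⬝ᵥ (A *ᵥ x) < 0

theorem IsNegDefOnKer.nonpos {A : Matrix m m ℝ} {B : Matrix k m ℝ} (h : IsNegDefOnKer A B)
    {x : m → ℝ} (hx : B *ᵥ x = 0) : x ⬝ᵥ A *ᵥ x ≤ 0 := by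
  by_cases hx0 : x = 0
  · rw [hx0, zero_dotProduct]
  · exact (h x hx0 hx).le

theorem transpose_mul_sub_mul {A P : Matrix m m ℝ} {U : Matrix m k ℝ} (hPU : P * U = 0) :
    Uᵀ * (A - P) * U = Uᵀ * A * U := by
  rw [Matrix.mul_sub, Matrix.sub_mul, Matrix.mul_assoc Uᵀ P, hPU, Matrix.mul_zero, sub_zero]

section Fintype

variable [Fintype k]

theorem card_le_finrank_ker_transpose_add_card (U : Matrix m k ℝ) :
    Fintype.card m ≤ Fintype.card k + Module.finrank ℝ (LinearMap.ker Uᵀ.mulVecLin) := by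
  have hrange := (LinearMap.range Uᵀ.mulVecLin).finrank_le
  have hsum := Uᵀ.mulVecLin.finrank_range_add_finrank_ker
  rw [Module.finrank_fintype_fun_eq_card] at hrange hsum
  omega

theorem isPosDefForm_transpose_mul_mul {C : Matrix m m ℝ} (hC : C.IsHermitian)
    {E F : Matrix m k ℝ} (hE : (Eᵀ * C * E).PosDef) (hF : (Fᵀ * C * F).PosDef)
    (hEF : ∀ x, (E *ᵥ x - F *ᵥ x) ⬝ᵥ C *ᵥ (E *ᵥ x - F *ᵥ x) ≤ 0) :
    IsPosDefForm (Eᵀ * C * F) := fun x hx => by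
  have hEx := hE.dotProduct_mulVec_pos hx
  have hFx := hF.dotProduct_mulVec_pos hx
  have hle := hEF x
  have hcross : x ⬝ᵥ (Eᵀ * C * F) *ᵥ x = (E *ᵥ x) ⬝ᵥ C *ᵥ (F *ᵥ x) := by
    rw [Matrix.mul_assoc, ← Matrix.mulVec_mulVec, ← Matrix.mulVec_mulVec,
      Matrix.dotProduct_transpose_mulVec, dotProduct_comm]
  rw [star_trivial, dotProduct_transpose_mul_mul_mulVec] at hEx hFx
  rw [Matrix.mulVec_sub, sub_dotProduct, dotProduct_sub, dotProduct_sub,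
    dotProduct_mulVec_comm hC (F *ᵥ x)] at hle
  rw [hcross]
  linarith

variable {D P : Matrix m m ℝ} {U E : Matrix m k ℝ}

theorem dotProduct_mulVec_pos_of_mulVec_eq (hD : D.IsHermitian) (hneg : IsNegDefOnKer D Uᵀ)
    (hpos : ∀ x ≠ 0, ∃ u, Uᵀ *ᵥ u = x ∧ 0 < u ⬝ᵥ D *ᵥ u)
    {z : m → ℝ} (hz : z ≠ 0) {y : k → ℝ} (hDz : D *ᵥ z = U *ᵥ y) : 0 < z ⬝ᵥ D *ᵥ z := by
  have hpair : ∀ u, u ⬝ᵥ D *ᵥ z = (Uᵀ *ᵥ u) ⬝ᵥ y := fun u => by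
    rw [hDz, ← Matrix.dotProduct_transpose_mulVec, dotProduct_comm]
  have hUz : Uᵀ *ᵥ z ≠ 0 := fun h => by
    simpa [hpair, h] using hneg z hz h
  obtain ⟨u, huz, hu⟩ := hpos _ hUz
  have hle := hneg.nonpos (x := u - z) (by rw [Matrix.mulVec_sub, huz, sub_self])
  have huDz : u ⬝ᵥ D *ᵥ z = z ⬝ᵥ D *ᵥ z := by rw [hpair, huz, ← hpair]
  rw [Matrix.mulVec_sub, sub_dotProduct, dotProduct_sub, dotProduct_sub,
    dotProduct_mulVec_comm hD z u, huDz] at hle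
  linarith

variable [DecidableEq m]

theorem posDef_transpose_mul_inv_mul_of_mulVec_eq {A : Matrix m m ℝ} (hA : A.IsHermitian)
    (hu : IsUnit A) (hE : Function.Injective E.mulVec)
    (hpos : ∀ z ≠ 0, ∀ y, A *ᵥ z = E *ᵥ y → 0 < z ⬝ᵥ A *ᵥ z) : (Eᵀ * A⁻¹ * E).PosDef := by
  refine .of_dotProduct_mulVec_pos
    (by simpa using Matrix.isHermitian_conjTranspose_mul_mul E hA.inv) fun y hy => ?_
  have hAz : A *ᵥ A⁻¹ *ᵥ E *ᵥ y = E *ᵥ y := mulVec_inv_mulVec hu _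
  have hz : A⁻¹ *ᵥ E *ᵥ y ≠ 0 := fun h => by
    rw [h, Matrix.mulVec_zero, ← Matrix.mulVec_zero E] at hAz
    exact hy (hE hAz).symm
  have h := hpos _ hz y hAz
  rwa [hAz, dotProduct_comm, ← dotProduct_transpose_mul_mul_mulVec] at h

theorem inertia_inv_sub (hD : D.IsHermitian) (hDu : IsUnit D)
    (hneg : IsNegDefOnKer D Uᵀ) (hU : (Uᵀ * D⁻¹ * U).PosDef)
    (hP : P.PosSemidef) (hPU : P * U = 0) :
    inertia (D⁻¹ - P) = (Fintype.card m - Fintype.card k, 0, Fintype.card k) := by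
  let K := LinearMap.ker Uᵀ.mulVecLin
  have hpos : ∀ y ≠ 0, 0 < U.mulVecLin y ⬝ᵥ (D⁻¹ - P) *ᵥ U.mulVecLin y := fun y hy => by
    rw [Matrix.mulVecLin_apply, ← dotProduct_transpose_mul_mul_mulVec,
      transpose_mul_sub_mul hPU]
    exact hU.dotProduct_mulVec_pos hy
  have hneg' : ∀ z : K, z ≠ 0 → (D.mulVecLin ∘ₗ K.subtype) z ⬝ᵥ
      (D⁻¹ - P) *ᵥ (D.mulVecLin ∘ₗ K.subtype) z < 0 := fun ⟨z, hz⟩ hz0 => by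
    have hPz := hP.dotProduct_mulVec_nonneg (D *ᵥ z)
    have hDz := hneg z (fun h => hz0 (Subtype.ext h)) hz
    simp only [LinearMap.comp_apply, Submodule.subtype_apply, Matrix.mulVecLin_apply,
      Matrix.sub_mulVec, dotProduct_sub, inv_mulVec_mulVec hDu, star_trivial] at hPz ⊢
    rw [dotProduct_comm] at hDz
    linarith
  have h := inertia_eq_of_posDef_of_negDef (hD.inv.sub hP.isHermitian) U.mulVecLin hpos
    (D.mulVecLin ∘ₗ K.subtype) hneg'
    (by rw [Module.finrank_fintype_fun_eq_card]; exact card_le_finrank_ker_transpose_add_card U)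
  rwa [Module.finrank_fintype_fun_eq_card] at h

end Fintype

section Finite

variable [DecidableEq m] [Finite k] {D : Matrix m m ℝ} {U E : Matrix m k ℝ}

theorem isUnit_of_isNegDefOnKer (hD : D.IsHermitian) (hneg : IsNegDefOnKer D Uᵀ)
    (hpos : ∀ x ≠ 0, ∃ u, Uᵀ *ᵥ u = x ∧ 0 < u ⬝ᵥ D *ᵥ u) : IsUnit D := by
  have := Fintype.ofFinite k
  refine Matrix.mulVec_injective_iff_isUnit.1
    ((injective_iff_map_eq_zero D.mulVecLin).2 fun z hz => ?_)
  rw [Matrix.mulVecLin_apply] at hz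
  by_contra hz0
  have h := dotProduct_mulVec_pos_of_mulVec_eq hD hneg hpos hz0 (y := 0)
    (by rw [hz, Matrix.mulVec_zero])
  simp [hz] at h

theorem posDef_transpose_mul_inv_mul (hD : D.IsHermitian) (hneg : IsNegDefOnKer D Uᵀ)
    (hpos : ∀ x ≠ 0, ∃ u, Uᵀ *ᵥ u = x ∧ 0 < u ⬝ᵥ D *ᵥ u) : (Uᵀ * D⁻¹ * U).PosDef := by
  have := Fintype.ofFinite k
  have hU : Function.Injective U.mulVec := by
    refine (injective_iff_map_eq_zero U.mulVecLin).2 fun y hy => ?_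
    by_contra hy0
    obtain ⟨u, huy, -⟩ := hpos y hy0
    rw [Matrix.mulVecLin_apply] at hy
    refine hy0 (dotProduct_self_eq_zero.1 ?_)
    nth_rewrite 2 [← huy]
    rw [Matrix.dotProduct_transpose_mulVec, hy, dotProduct_zero]
  exact posDef_transpose_mul_inv_mul_of_mulVec_eq hD (isUnit_of_isNegDefOnKer hD hneg hpos) hU
    fun _ hz _ => dotProduct_mulVec_pos_of_mulVec_eq hD hneg hpos hz

theorem dotProduct_inv_mulVec_nonpos_of_transpose_mulVec_eq_zero (hD : D.IsHermitian)
    (hu : IsUnit D) (hneg : IsNegDefOnKer D Uᵀ) [DecidableEq k] (hUE : Uᵀ * E = 1)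
    (hE : Eᵀ * D * E = 0) {w : m → ℝ} (hw : Eᵀ *ᵥ w = 0) : w ⬝ᵥ D⁻¹ *ᵥ w ≤ 0 := by
  have := Fintype.ofFinite k
  let z := D⁻¹ *ᵥ w
  let e := E *ᵥ Uᵀ *ᵥ z
  have hDz : D *ᵥ z = w := mulVec_inv_mulVec hu w
  have hew : e ⬝ᵥ w = 0 := by
    rw [dotProduct_comm, ← Matrix.dotProduct_transpose_mulVec, hw, dotProduct_zero]
  have hee : e ⬝ᵥ D *ᵥ e = 0 := by
    rw [← dotProduct_transpose_mul_mul_mulVec, hE, Matrix.zero_mulVec, dotProduct_zero]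
  have hle := hneg.nonpos (x := z - e)
    (by rw [Matrix.mulVec_sub, Matrix.mulVec_mulVec _ Uᵀ E, hUE, Matrix.one_mulVec, sub_self])
  rw [Matrix.mulVec_sub, sub_dotProduct, dotProduct_sub, dotProduct_sub,
    dotProduct_mulVec_comm hD z e, hee, hDz, hew, dotProduct_comm] at hle
  linarith

theorem posDef_transpose_mul_inv_mul_of_isNegDefOnKer [DecidableEq k] {A : Matrix m m ℝ}
    (hA : A.IsHermitian) (hu : IsUnit A) (hU : (Uᵀ * A * U).PosDef) (hUE : Uᵀ * E = 1)
    (hneg : IsNegDefOnKer A Eᵀ) : (Eᵀ * A⁻¹ * E).PosDef := by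
  have := Fintype.ofFinite k
  have hE : Function.Injective E.mulVec := fun x y hxy => by
    rw [← Matrix.one_mulVec x, ← Matrix.one_mulVec y, ← hUE, ← Matrix.mulVec_mulVec, hxy,
      Matrix.mulVec_mulVec]
  have hEU : Eᵀ * U = 1 := by
    rw [← Matrix.transpose_inj, Matrix.transpose_mul, Matrix.transpose_transpose, hUE,
      Matrix.transpose_one]
  refine posDef_transpose_mul_inv_mul_of_mulVec_eq hA hu hE fun v hv x hAv => ?_
  let c := U *ᵥ Eᵀ *ᵥ v
  have hvAv : v ⬝ᵥ A *ᵥ v = (Eᵀ *ᵥ v) ⬝ᵥ x := by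
    rw [hAv, ← Matrix.dotProduct_transpose_mulVec, dotProduct_comm]
  have hcAv : c ⬝ᵥ A *ᵥ v = v ⬝ᵥ A *ᵥ v := by
    rw [hvAv, hAv, dotProduct_comm, ← Matrix.dotProduct_transpose_mulVec,
      Matrix.mulVec_mulVec _ Uᵀ E, hUE, Matrix.one_mulVec]
  have hker : Eᵀ *ᵥ (v - c) = 0 := by
    rw [Matrix.mulVec_sub, Matrix.mulVec_mulVec _ Eᵀ U, hEU, Matrix.one_mulVec, sub_self]
  have hle := hneg.nonpos hker
  rw [Matrix.mulVec_sub, sub_dotProduct, dotProduct_sub, dotProduct_sub,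
    dotProduct_mulVec_comm hA v c, hcAv] at hle
  have hy : Eᵀ *ᵥ v ≠ 0 := fun h => by
    simpa [hvAv, h] using hneg v hv h
  have hcAc := hU.dotProduct_mulVec_pos hy
  rw [star_trivial, dotProduct_transpose_mul_mul_mulVec] at hcAc
  linarith

end Finite

end NegDefOnKer

section Blocks

variable {n s : ℕ}

/-- The block column of height `n` whose `i`-th block is the identity and whose other blocks
vanish: multiplication by it embeds `ℝˢ` as the `i`-th block, and by its transpose extracts the
`i`-th block. -/
def blockSingle (n s : ℕ) (i : Fin n) : Matrix (Fin n × Fin s) (Fin s) ℝ :=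
  (1 : Matrix (Fin n × Fin s) (Fin n × Fin s) ℝ).submatrix id (Prod.mk i)

theorem transpose_blockSingle_mulVec_apply (i : Fin n) (x : Fin n × Fin s → ℝ) (a : Fin s) :
    ((blockSingle n s i)ᵀ *ᵥ x) a = x (i, a) := by
  simp [blockSingle, Matrix.mulVec, dotProduct, Matrix.one_apply]

theorem transpose_blockSingle_mul_apply {k : Type*} (i : Fin n) (A : Matrix (Fin n × Fin s) k ℝ)
    (a : Fin s) (q : k) : ((blockSingle n s i)ᵀ * A) a q = A (i, a) q := by
  simp [blockSingle, Matrix.mul_apply, Matrix.one_apply]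

theorem mul_blockSingle_apply {k : Type*} (j : Fin n) (A : Matrix k (Fin n × Fin s) ℝ)
    (p : k) (b : Fin s) : (A * blockSingle n s j) p b = A p (j, b) := by
  simp [blockSingle, Matrix.mul_apply, Matrix.one_apply]

theorem blockAt_eq (A : Matrix (Fin n × Fin s) (Fin n × Fin s) ℝ) (i j : Fin n) :
    blockAt A i j = (blockSingle n s i)ᵀ * A * blockSingle n s j := by
  ext a b
  rw [mul_blockSingle_apply, transpose_blockSingle_mul_apply, blockAt, Matrix.of_apply]

theorem transpose_blockSingle_mul_blockSingle (i j : Fin n) :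
    (blockSingle n s i)ᵀ * blockSingle n s j = if i = j then 1 else 0 := by
  ext a b
  rw [transpose_blockSingle_mul_apply]
  split_ifs with h <;> simp [blockSingle, Matrix.one_apply, h]

theorem transpose_blockSingle_mul_blockOnes (i : Fin n) :
    (blockSingle n s i)ᵀ * blockOnes n s = 1 := by
  ext a b
  rw [transpose_blockSingle_mul_apply, blockOnes, Matrix.of_apply]

theorem transpose_blockOnes_mul_blockSingle (i : Fin n) :
    (blockOnes n s)ᵀ * blockSingle n s i = 1 := by
  rw [← Matrix.transpose_inj, Matrix.transpose_mul, Matrix.transpose_transpose,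
    transpose_blockSingle_mul_blockOnes, Matrix.transpose_one]

theorem blockRows_ext {k : Type*} {A B : Matrix (Fin n × Fin s) k ℝ}
    (h : ∀ i, (blockSingle n s i)ᵀ * A = (blockSingle n s i)ᵀ * B) : A = B := by
  ext ⟨i, a⟩ q
  rw [← transpose_blockSingle_mul_apply i A, h, transpose_blockSingle_mul_apply]

theorem blocks_ext {A B : Matrix (Fin n × Fin s) (Fin n × Fin s) ℝ}
    (h : ∀ i j, (blockSingle n s i)ᵀ * A * blockSingle n s j =
      (blockSingle n s i)ᵀ * B * blockSingle n s j) : A = B := by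
  simp only [← blockAt_eq] at h
  ext ⟨i, a⟩ ⟨j, b⟩
  exact congrFun₂ (h i j) a b

theorem sum_blockSingle_mul_transpose :
    ∑ i, blockSingle n s i * (blockSingle n s i)ᵀ = 1 := by
  refine blockRows_ext fun j => ?_
  simp only [Matrix.mul_sum, ← Matrix.mul_assoc, transpose_blockSingle_mul_blockSingle]
  rw [Finset.sum_eq_single j (fun i _ hij => by simp [hij.symm]) (by simp)]
  simp

theorem blockJ_eq : blockJ n s = blockOnes n s * (blockOnes n s)ᵀ := by
  ext p q
  simp [blockJ, ofBlocks, blockOnes, Matrix.mul_apply, Matrix.one_apply, eq_comm]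

theorem transpose_blockOnes_mulVec_eq_zero {x : Fin n × Fin s → ℝ}
    (hx : blockJ n s *ᵥ x = 0) : (blockOnes n s)ᵀ *ᵥ x = 0 := by
  rw [blockJ_eq, ← Matrix.conjTranspose_eq_transpose_of_trivial] at hx
  exact (Matrix.self_mul_conjTranspose_mulVec_eq_zero _ _).1 hx

/-- The columns of the identity matrix in the blocks belonging to `Δ`: multiplication by it extends
a vector on these blocks by zero. -/
def blockInclusion (s : ℕ) (Δ : Finset (Fin n)) : Matrix (Fin n × Fin s) (Δ × Fin s) ℝ :=
  (1 : Matrix (Fin n × Fin s) (Fin n × Fin s) ℝ).submatrix id fun p => (p.1, p.2)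

theorem principalBlocks_eq (A : Matrix (Fin n × Fin s) (Fin n × Fin s) ℝ) (Δ : Finset (Fin n)) :
    principalBlocks A Δ = (blockInclusion s Δ)ᵀ * A * blockInclusion s Δ := by
  ext p q
  simp [principalBlocks, blockInclusion, Matrix.mul_apply, Matrix.one_apply]

theorem transpose_blockInclusion_mul_blockInclusion (Δ : Finset (Fin n)) :
    (blockInclusion s Δ)ᵀ * blockInclusion s Δ = 1 := by
  rw [← Matrix.mul_one (blockInclusion s Δ)ᵀ, ← principalBlocks_eq]
  exact Matrix.submatrix_one _ (Subtype.val_injective.prodMap Function.injective_id)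

theorem transpose_blockSingle_mul_blockInclusion {i : Fin n} {Δ : Finset (Fin n)} (hi : i ∉ Δ) :
    (blockSingle n s i)ᵀ * blockInclusion s Δ = 0 := by
  ext a ⟨j, b⟩
  have hij : i ≠ j := fun h => hi (h ▸ j.2)
  simp [transpose_blockSingle_mul_apply, blockInclusion, hij]

variable {A : Matrix (Fin n × Fin s) (Fin n × Fin s) ℝ} {i : Fin n} {Δ : Finset (Fin n)}

theorem isHermitian_neg_principalBlocks (hA : A.IsHermitian) (Δ : Finset (Fin n)) :
    (-principalBlocks A Δ).IsHermitian :=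
  .neg <| .ext fun p q => hA.apply (p.1, p.2) (q.1, q.2)

theorem dotProduct_principalBlocks_mulVec (w : Δ × Fin s → ℝ) :
    w ⬝ᵥ principalBlocks A Δ *ᵥ w =
      (blockInclusion s Δ *ᵥ w) ⬝ᵥ A *ᵥ (blockInclusion s Δ *ᵥ w) := by
  rw [principalBlocks_eq, dotProduct_transpose_mul_mul_mulVec]

theorem neg_principalBlocks_posSemidef (hA : A.IsHermitian) (hi : i ∉ Δ)
    (h : ∀ x, (blockSingle n s i)ᵀ *ᵥ x = 0 → x ⬝ᵥ A *ᵥ x ≤ 0) :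
    (-principalBlocks A Δ).PosSemidef := by
  refine .of_dotProduct_mulVec_nonneg (isHermitian_neg_principalBlocks hA Δ) fun w => ?_
  rw [star_trivial, Matrix.neg_mulVec, dotProduct_neg, Left.nonneg_neg_iff,
    dotProduct_principalBlocks_mulVec]
  exact h _ (by rw [Matrix.mulVec_mulVec, transpose_blockSingle_mul_blockInclusion hi,
    Matrix.zero_mulVec])

theorem neg_principalBlocks_posDef (hA : A.IsHermitian) (hi : i ∉ Δ)
    (h : IsNegDefOnKer A (blockSingle n s i)ᵀ) : (-principalBlocks A Δ).PosDef := by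
  refine .of_dotProduct_mulVec_pos (isHermitian_neg_principalBlocks hA Δ) fun w hw => ?_
  rw [star_trivial, Matrix.neg_mulVec, dotProduct_neg, Left.neg_pos_iff,
    dotProduct_principalBlocks_mulVec]
  refine h _ (fun hw0 => hw ?_) (by rw [Matrix.mulVec_mulVec,
    transpose_blockSingle_mul_blockInclusion hi, Matrix.zero_mulVec])
  rw [← Matrix.one_mulVec w, ← transpose_blockInclusion_mul_blockInclusion,
    ← Matrix.mulVec_mulVec, hw0, Matrix.mulVec_zero]

end Blocks

namespace WeightedGraph

section Laplacian

variable {n s : ℕ} (G : WeightedGraph n s)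

theorem weight_posDef_of_adj {i j : Fin n} (h : G.graph.Adj i j) :
    (G.weight s(i, j)).PosDef :=
  G.weight_posDef _ (G.graph.mem_edgeSet.2 h)

theorem invWeight_of_adj {i j : Fin n} (h : G.graph.Adj i j) :
    G.invWeight i j = (G.weight s(i, j))⁻¹ :=
  if_pos h

theorem invWeight_of_not_adj {i j : Fin n} (h : ¬G.graph.Adj i j) : G.invWeight i j = 0 :=
  if_neg h

theorem invWeight_comm (i j : Fin n) : G.invWeight i j = G.invWeight j i := by
  by_cases h : G.graph.Adj i j
  · rw [G.invWeight_of_adj h, G.invWeight_of_adj h.symm, Sym2.eq_swap]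
  · rw [G.invWeight_of_not_adj h, G.invWeight_of_not_adj (mt .symm h)]

theorem invWeight_posDef {i j : Fin n} (h : G.graph.Adj i j) : (G.invWeight i j).PosDef := by
  rw [G.invWeight_of_adj h]
  exact (G.weight_posDef_of_adj h).inv

theorem invWeight_posSemidef (i j : Fin n) : (G.invWeight i j).PosSemidef := by
  by_cases h : G.graph.Adj i j
  · exact (G.invWeight_posDef h).posSemidef
  · rw [G.invWeight_of_not_adj h]
    exact .zero

theorem transpose_blockSingle_mul_laplacian (i : Fin n) :
    (blockSingle n s i)ᵀ * G.laplacian =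
      ∑ k, G.invWeight i k * (blockSingle n s i - blockSingle n s k)ᵀ := by
  have hentry : ∀ (W : Matrix (Fin s) (Fin s) ℝ) (k j : Fin n) (a b : Fin s),
      (W * (blockSingle n s k)ᵀ) a (j, b) = if k = j then W a b else 0 := fun W k j a b => by
    simp [blockSingle, Matrix.mul_apply, Matrix.one_apply, ite_and, Finset.sum_ite_irrel]
  ext a ⟨j, b⟩
  rw [transpose_blockSingle_mul_apply]
  by_cases hij : i = j
  · subst hij
    simp [laplacian, ofBlocks, Matrix.mul_sub, Matrix.sum_apply, hentry, invWeight_of_not_adj]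
  · simp [laplacian, ofBlocks, Matrix.mul_sub, Matrix.sum_apply, hentry, hij]

theorem laplacian_mul_blockOnes : G.laplacian * blockOnes n s = 0 := by
  refine blockRows_ext fun i => ?_
  rw [← Matrix.mul_assoc, transpose_blockSingle_mul_laplacian, Matrix.mul_zero, Matrix.sum_mul]
  refine Finset.sum_eq_zero fun k _ => ?_
  rw [Matrix.mul_assoc, Matrix.transpose_sub, Matrix.sub_mul, transpose_blockSingle_mul_blockOnes,
    transpose_blockSingle_mul_blockOnes, sub_self, Matrix.mul_zero]

theorem two_smul_laplacian :
    (2 : ℝ) • G.laplacian = ∑ i, ∑ k, (blockSingle n s i - blockSingle n s k) * G.invWeight i k *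
      (blockSingle n s i - blockSingle n s k)ᵀ := by
  have hL : G.laplacian = ∑ i, ∑ k, blockSingle n s i * G.invWeight i k *
      (blockSingle n s i - blockSingle n s k)ᵀ := by
    rw [← Matrix.one_mul G.laplacian, ← sum_blockSingle_mul_transpose, Matrix.sum_mul]
    simp only [Matrix.mul_assoc, transpose_blockSingle_mul_laplacian, Matrix.mul_sum]
  have hswap : G.laplacian = -∑ i, ∑ k, blockSingle n s k * G.invWeight i k *
      (blockSingle n s i - blockSingle n s k)ᵀ := by
    rw [Finset.sum_comm, hL]
    simp only [← Finset.sum_neg_distrib, ← Matrix.mul_neg, ← Matrix.transpose_neg, neg_sub,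
      G.invWeight_comm]
  rw [two_smul]
  nth_rewrite 2 [hswap]
  rw [← sub_eq_add_neg]
  nth_rewrite 1 [hL]
  simp only [Matrix.sub_mul, Finset.sum_sub_distrib]

theorem two_mul_dotProduct_laplacian_mulVec (x : Fin n × Fin s → ℝ) :
    2 * (x ⬝ᵥ G.laplacian *ᵥ x) = ∑ i, ∑ k, ((blockSingle n s i - blockSingle n s k)ᵀ *ᵥ x) ⬝ᵥ
      G.invWeight i k *ᵥ ((blockSingle n s i - blockSingle n s k)ᵀ *ᵥ x) := by
  rw [← smul_eq_mul, ← dotProduct_smul, ← Matrix.smul_mulVec, two_smul_laplacian]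
  simp only [Matrix.sum_mulVec, dotProduct_sum, ← dotProduct_transpose_mul_mul_mulVec,
    Matrix.transpose_transpose]

theorem laplacian_posSemidef : G.laplacian.PosSemidef := by
  have h : ((2 : ℝ) • G.laplacian).PosSemidef := by
    rw [two_smul_laplacian]
    refine Matrix.posSemidef_sum _ fun i _ => Matrix.posSemidef_sum _ fun k _ => ?_
    exact (G.invWeight_posSemidef i k).mul_mul_conjTranspose_same _
  simpa [smul_smul] using h.smul (inv_nonneg.2 zero_le_two : (0 : ℝ) ≤ 2⁻¹)

variable {G}

theorem transpose_blockSingle_mulVec_eq_of_adj {x : Fin n × Fin s → ℝ}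
    (hx : x ⬝ᵥ G.laplacian *ᵥ x = 0) {i j : Fin n} (hij : G.graph.Adj i j) :
    (blockSingle n s i)ᵀ *ᵥ x = (blockSingle n s j)ᵀ *ᵥ x := by
  have hnonneg : ∀ i k, 0 ≤ ((blockSingle n s i - blockSingle n s k)ᵀ *ᵥ x) ⬝ᵥ
      G.invWeight i k *ᵥ ((blockSingle n s i - blockSingle n s k)ᵀ *ᵥ x) :=
    fun i k => (G.invWeight_posSemidef i k).dotProduct_mulVec_nonneg _
  have hsum := G.two_mul_dotProduct_laplacian_mulVec x
  rw [hx, mul_zero, eq_comm, Fintype.sum_eq_zero_iff_of_nonneg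
    fun i => Finset.sum_nonneg fun k _ => hnonneg i k] at hsum
  have hterm := congrFun ((Fintype.sum_eq_zero_iff_of_nonneg (hnonneg i)).1 (congrFun hsum i)) j
  by_contra hne
  have hdiff : (blockSingle n s i - blockSingle n s j)ᵀ *ᵥ x ≠ 0 := by
    rwa [Matrix.transpose_sub, Matrix.sub_mulVec, sub_ne_zero]
  exact ((G.invWeight_posDef hij).dotProduct_mulVec_pos hdiff).ne' hterm

theorem transpose_blockSingle_mulVec_eq (hG : G.graph.Preconnected) {x : Fin n × Fin s → ℝ}
    (hx : x ⬝ᵥ G.laplacian *ᵥ x = 0) (i j : Fin n) :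
    (blockSingle n s i)ᵀ *ᵥ x = (blockSingle n s j)ᵀ *ᵥ x := by
  obtain ⟨p⟩ := hG i j
  induction p with
  | nil => rfl
  | cons hadj _ ih => exact (transpose_blockSingle_mulVec_eq_of_adj hx hadj).trans ih

theorem dotProduct_laplacian_mulVec_pos (hG : G.graph.Preconnected) {x : Fin n × Fin s → ℝ}
    (hx : x ≠ 0) {i : Fin n} (hxi : (blockSingle n s i)ᵀ *ᵥ x = 0) :
    0 < x ⬝ᵥ G.laplacian *ᵥ x := by
  refine lt_of_le_of_ne (G.laplacian_posSemidef.dotProduct_mulVec_nonneg x) fun h => hx ?_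
  ext ⟨j, a⟩
  rw [← transpose_blockSingle_mulVec_apply j x, transpose_blockSingle_mulVec_eq hG h.symm j i, hxi]
  rfl

end Laplacian

section Tree

variable {n s : ℕ} {T : WeightedGraph n s} (hT : T.graph.IsTree)

theorem walkWeight_cons {i j k : Fin n} (h : T.graph.Adj i j) (p : T.graph.Walk j k) :
    T.walkWeight (.cons h p) = T.weight s(i, j) + T.walkWeight p := by
  simp [walkWeight]

theorem walkWeight_posSemidef {i j : Fin n} (p : T.graph.Walk i j) :
    (T.walkWeight p).PosSemidef := by
  induction p with
  | nil => exact .zero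
  | cons h p ih =>
    rw [walkWeight_cons]
    exact (T.weight_posDef_of_adj h).posSemidef.add ih

theorem exists_isPath_treeDist_eq (i j : Fin n) :
    ∃ p : T.graph.Walk i j, p.IsPath ∧ T.treeDist hT i j = T.walkWeight p := by
  obtain ⟨p, hp, -⟩ := hT.existsUnique_path i j
  exact ⟨p, hp, T.treeDist_eq_walkWeight hT p hp⟩

theorem treeDist_self (i : Fin n) : T.treeDist hT i i = 0 := if_pos rfl

theorem treeDist_comm (i j : Fin n) : T.treeDist hT i j = T.treeDist hT j i := by
  obtain ⟨p, hp, h⟩ := exists_isPath_treeDist_eq hT i j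
  rw [h, T.treeDist_eq_walkWeight hT p.reverse hp.reverse]
  simp [walkWeight, List.sum_reverse]

theorem treeDist_posDef {i j : Fin n} (hij : i ≠ j) : (T.treeDist hT i j).PosDef := by
  obtain ⟨p, -, hp⟩ := exists_isPath_treeDist_eq hT i j
  rw [hp]
  cases p with
  | nil => exact absurd rfl hij
  | cons h p =>
    rw [walkWeight_cons]
    exact (T.weight_posDef_of_adj h).add_posSemidef (walkWeight_posSemidef p)

theorem treeDist_isHermitian (i j : Fin n) : (T.treeDist hT i j).IsHermitian := by
  obtain ⟨p, -, hp⟩ := exists_isPath_treeDist_eq hT i j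
  rw [hp]
  exact (walkWeight_posSemidef p).isHermitian

theorem blockAt_distMatrix (i j : Fin n) : blockAt (T.distMatrix hT) i j = T.treeDist hT i j :=
  rfl

theorem distMatrix_isHermitian : (T.distMatrix hT).IsHermitian := by
  ext ⟨i, a⟩ ⟨j, b⟩
  simpa [distMatrix, ofBlocks, treeDist_comm hT j i] using (treeDist_isHermitian hT i j).apply a b

theorem treeDist_of_isPath_cons {i j k : Fin n} {h : T.graph.Adj i k} {p : T.graph.Walk k j}
    (hp : (SimpleGraph.Walk.cons h p).IsPath) :
    T.treeDist hT i j = T.weight s(i, k) + T.treeDist hT k j := by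
  rw [T.treeDist_eq_walkWeight hT _ hp, T.treeDist_eq_walkWeight hT _ hp.of_cons, walkWeight_cons]

theorem invWeight_mul_treeDist_sub_of_isPath_cons {i j k : Fin n} {h : T.graph.Adj i k}
    {p : T.graph.Walk k j} (hp : (SimpleGraph.Walk.cons h p).IsPath) :
    T.invWeight i k * (T.treeDist hT i j - T.treeDist hT k j) = 1 := by
  rw [treeDist_of_isPath_cons hT hp, add_sub_cancel_right, T.invWeight_of_adj h,
    Matrix.nonsing_inv_mul _ ((Matrix.isUnit_iff_isUnit_det _).1 (T.weight_posDef_of_adj h).isUnit)]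

theorem invWeight_mul_treeDist_sub_of_notMem_support {i j k : Fin n} (h : T.graph.Adj i k)
    {p : T.graph.Walk i j} (hp : p.IsPath) (hk : k ∉ p.support) :
    T.invWeight i k * (T.treeDist hT i j - T.treeDist hT k j) = -1 := by
  rw [← neg_sub, Matrix.mul_neg, T.invWeight_comm, invWeight_mul_treeDist_sub_of_isPath_cons hT
    ((SimpleGraph.Walk.cons_isPath_iff h.symm p).2 ⟨hp, hk⟩)]

open Classical in
theorem sum_adj_one (i : Fin n) :
    ∑ k, (if T.graph.Adj i k then (1 : Matrix (Fin s) (Fin s) ℝ) else 0) =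
      (T.graph.degree i : ℝ) • 1 := by
  rw [← Finset.sum_filter, Finset.sum_const, ← SimpleGraph.neighborFinset_eq_filter,
    SimpleGraph.card_neighborFinset_eq_degree, Nat.cast_smul_eq_nsmul]

open Classical in
theorem sum_invWeight_mul_treeDist_sub_self (i : Fin n) :
    ∑ k, T.invWeight i k * (T.treeDist hT i i - T.treeDist hT k i) =
      -((T.graph.degree i : ℝ) • 1) := by
  rw [← sum_adj_one, ← Finset.sum_neg_distrib]
  refine Finset.sum_congr rfl fun k _ => ?_
  split_ifs with hk
  · exact invWeight_mul_treeDist_sub_of_notMem_support hT hk .nil (by simpa using hk.ne')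
  · rw [T.invWeight_of_not_adj hk, Matrix.zero_mul, neg_zero]

open Classical in
theorem sum_invWeight_mul_treeDist_sub {i j : Fin n} (hij : i ≠ j) :
    ∑ k, T.invWeight i k * (T.treeDist hT i j - T.treeDist hT k j) =
      (2 - T.graph.degree i : ℝ) • 1 := by
  obtain ⟨p, hp, -⟩ := exists_isPath_treeDist_eq hT i j
  cases p with
  | nil => exact absurd rfl hij
  | @cons _ next _ hnext p =>
    have hterm : ∀ k, T.invWeight i k * (T.treeDist hT i j - T.treeDist hT k j) =
        (if k = next then (2 : ℝ) • 1 else 0) - (if T.graph.Adj i k then 1 else 0) := fun k => by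
      by_cases hk : T.graph.Adj i k
      · by_cases hnext' : k = next
        · subst hnext'
          rw [invWeight_mul_treeDist_sub_of_isPath_cons hT hp, if_pos rfl, if_pos hk, two_smul,
            add_sub_cancel_right]
        · have hsupp : k ∉ (SimpleGraph.Walk.cons hnext p).support := fun h =>
            hnext' (by simpa using hT.isAcyclic.eq_snd_of_adj_start hp hk h)
          rw [invWeight_mul_treeDist_sub_of_notMem_support hT hk hp hsupp, if_neg hnext',
            if_pos hk, zero_sub]
      · rw [T.invWeight_of_not_adj hk, Matrix.zero_mul, if_neg hk,
          if_neg fun h : k = next => hk (h ▸ hnext), sub_zero]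
    rw [Finset.sum_congr rfl fun k _ => hterm k, Finset.sum_sub_distrib, sum_adj_one,
      Finset.sum_ite_eq' Finset.univ next, if_pos (Finset.mem_univ next), sub_smul]

open Classical in
/-- The block column `τ ⊗ Iₛ`, where `τ i` is `2` minus the degree of the vertex `i`. It measures
how far the product of the Laplacian and the distance matrix of a tree is from `-2`. -/
noncomputable def degreeDefect (G : WeightedGraph n s) : Matrix (Fin n × Fin s) (Fin s) ℝ :=
  Matrix.of fun p b => (2 - G.graph.degree p.1 : ℝ) * (1 : Matrix (Fin s) (Fin s) ℝ) p.2 b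

open Classical in
theorem transpose_blockSingle_mul_degreeDefect (G : WeightedGraph n s) (i : Fin n) :
    (blockSingle n s i)ᵀ * G.degreeDefect = (2 - G.graph.degree i : ℝ) • 1 := by
  ext a b
  rw [transpose_blockSingle_mul_apply]
  rfl

theorem laplacian_mul_distMatrix :
    T.laplacian * T.distMatrix hT =
      T.degreeDefect * (blockOnes n s)ᵀ - (2 : ℝ) • 1 := by
  classical
  refine blocks_ext fun i j => ?_
  have hleft : (blockSingle n s i)ᵀ * (T.laplacian * T.distMatrix hT) * blockSingle n s j =
      ∑ k, T.invWeight i k * (T.treeDist hT i j - T.treeDist hT k j) := by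
    rw [← Matrix.mul_assoc, transpose_blockSingle_mul_laplacian, Matrix.sum_mul, Matrix.sum_mul]
    simp only [Matrix.mul_assoc, Matrix.transpose_sub, Matrix.sub_mul, ← blockAt_distMatrix,
      blockAt_eq]
  have hright : (blockSingle n s i)ᵀ * (T.degreeDefect * (blockOnes n s)ᵀ - (2 : ℝ) • 1) *
      blockSingle n s j = (2 - T.graph.degree i : ℝ) • 1 - (2 : ℝ) • if i = j then 1 else 0 := by
    rw [Matrix.mul_sub, ← Matrix.mul_assoc, Matrix.sub_mul, Matrix.mul_assoc,
      transpose_blockOnes_mul_blockSingle, transpose_blockSingle_mul_degreeDefect, Matrix.mul_one,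
      Matrix.mul_smul, Matrix.mul_one, Matrix.smul_mul, transpose_blockSingle_mul_blockSingle]
  rw [hleft, hright]
  split_ifs with hij
  · subst hij
    rw [sum_invWeight_mul_treeDist_sub_self]
    module
  · rw [sum_invWeight_mul_treeDist_sub hT hij, smul_zero, sub_zero]

theorem laplacian_mulVec_distMatrix_mulVec {z : Fin n × Fin s → ℝ}
    (hz : (blockOnes n s)ᵀ *ᵥ z = 0) :
    T.laplacian *ᵥ T.distMatrix hT *ᵥ z = (-2 : ℝ) • z := by
  rw [Matrix.mulVec_mulVec, laplacian_mul_distMatrix, Matrix.sub_mulVec, ← Matrix.mulVec_mulVec,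
    hz, Matrix.mulVec_zero, Matrix.smul_mulVec, Matrix.one_mulVec]
  module

theorem distMatrix_isNegDefOnKer : IsNegDefOnKer (T.distMatrix hT) (blockOnes n s)ᵀ := by
  intro z hz0 hz
  have hLDz := laplacian_mulVec_distMatrix_mulVec hT hz
  have hform : (T.distMatrix hT *ᵥ z) ⬝ᵥ T.laplacian *ᵥ (T.distMatrix hT *ᵥ z) =
      -2 * (z ⬝ᵥ T.distMatrix hT *ᵥ z) := by
    rw [hLDz, dotProduct_smul, smul_eq_mul, dotProduct_comm]
  have hne : (T.distMatrix hT *ᵥ z) ⬝ᵥ T.laplacian *ᵥ (T.distMatrix hT *ᵥ z) ≠ 0 := fun h => by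
    have hker := (T.laplacian_posSemidef.dotProduct_mulVec_zero_iff (T.distMatrix hT *ᵥ z)).1 h
    rw [hLDz] at hker
    exact hz0 ((smul_eq_zero.1 hker).resolve_left (by norm_num))
  have hpos := (T.laplacian_posSemidef.dotProduct_mulVec_nonneg
    (T.distMatrix hT *ᵥ z)).lt_of_ne' hne
  rw [star_trivial, hform] at hpos
  linarith

theorem exists_dotProduct_distMatrix_mulVec_pos [Nontrivial (Fin n)] {x : Fin s → ℝ}
    (hx : x ≠ 0) :
    ∃ u, (blockOnes n s)ᵀ *ᵥ u = x ∧ 0 < u ⬝ᵥ T.distMatrix hT *ᵥ u := by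
  obtain ⟨i, j, hij⟩ := exists_pair_ne (Fin n)
  have hblock : ∀ i j, (blockSingle n s i *ᵥ x) ⬝ᵥ T.distMatrix hT *ᵥ (blockSingle n s j *ᵥ x) =
      x ⬝ᵥ T.treeDist hT i j *ᵥ x := fun i j => by
    rw [← blockAt_distMatrix, blockAt_eq, ← Matrix.mulVec_mulVec, ← Matrix.mulVec_mulVec,
      Matrix.dotProduct_transpose_mulVec, dotProduct_comm]
  refine ⟨(2⁻¹ : ℝ) • (blockSingle n s i *ᵥ x + blockSingle n s j *ᵥ x), ?_, ?_⟩
  · simp only [Matrix.mulVec_smul, Matrix.mulVec_add, Matrix.mulVec_mulVec,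
      transpose_blockOnes_mul_blockSingle, Matrix.one_mulVec]
    module
  · have hpos := (treeDist_posDef hT hij).dotProduct_mulVec_pos hx
    simp only [Matrix.mulVec_smul, Matrix.mulVec_add, smul_dotProduct, dotProduct_smul,
      add_dotProduct, dotProduct_add, hblock, treeDist_self, treeDist_comm hT j i,
      Matrix.zero_mulVec, dotProduct_zero, smul_eq_mul, star_trivial] at hpos ⊢
    linarith

end Tree

section InvSubLaplacian

variable {n s : ℕ} {T : WeightedGraph n s} (hT : T.graph.IsTree)
  {G : WeightedGraph n s} {β : ℝ}

/-- The matrix `D⁻¹ - β L`, where `D` is the distance matrix of a tree and `L` the Laplacian of a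
second weighted graph on the same vertices. -/
noncomputable def perturbedInv (G : WeightedGraph n s) (β : ℝ) :
    Matrix (Fin n × Fin s) (Fin n × Fin s) ℝ :=
  (T.distMatrix hT)⁻¹ - β • G.laplacian

theorem perturbedInv_isHermitian : (perturbedInv hT G β).IsHermitian :=
  (distMatrix_isHermitian hT).inv.sub (G.laplacian_posSemidef.isHermitian.smul (.all β))

theorem smul_laplacian_mul_blockOnes (β : ℝ) : (β • G.laplacian) * blockOnes n s = 0 := by
  rw [Matrix.smul_mul, laplacian_mul_blockOnes, smul_zero]

variable [Nontrivial (Fin n)]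

theorem isUnit_distMatrix : IsUnit (T.distMatrix hT) :=
  isUnit_of_isNegDefOnKer (distMatrix_isHermitian hT) (distMatrix_isNegDefOnKer hT)
    fun _ => exists_dotProduct_distMatrix_mulVec_pos hT

theorem posDef_transpose_blockOnes_mul_inv_distMatrix_mul :
    ((blockOnes n s)ᵀ * (T.distMatrix hT)⁻¹ * blockOnes n s).PosDef :=
  posDef_transpose_mul_inv_mul (distMatrix_isHermitian hT) (distMatrix_isNegDefOnKer hT)
    fun _ => exists_dotProduct_distMatrix_mulVec_pos hT

theorem posDef_transpose_blockOnes_mul_perturbedInv_mul :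
    ((blockOnes n s)ᵀ * perturbedInv hT G β * blockOnes n s).PosDef := by
  rw [perturbedInv, transpose_mul_sub_mul (smul_laplacian_mul_blockOnes β)]
  exact posDef_transpose_blockOnes_mul_inv_distMatrix_mul hT

theorem inertia_perturbedInv (hβ : 0 ≤ β) : inertia (perturbedInv hT G β) = (n * s - s, 0, s) := by
  have h := inertia_inv_sub (distMatrix_isHermitian hT) (isUnit_distMatrix hT)
    (distMatrix_isNegDefOnKer hT) (posDef_transpose_blockOnes_mul_inv_distMatrix_mul hT)
    (G.laplacian_posSemidef.smul hβ) (smul_laplacian_mul_blockOnes β)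
  rwa [Fintype.card_prod, Fintype.card_fin, Fintype.card_fin] at h

theorem isUnit_perturbedInv (hβ : 0 ≤ β) : IsUnit (perturbedInv hT G β) :=
  isUnit_of_nullity_eq_zero (congrArg (fun I : ℕ × ℕ × ℕ => I.2.1) (inertia_perturbedInv hT hβ))

theorem numPosEigenvalues_perturbedInv (hβ : 0 ≤ β) :
    numPosEigenvalues (perturbedInv hT G β) = s :=
  congrArg (fun I : ℕ × ℕ × ℕ => I.2.2) (inertia_perturbedInv hT hβ)

theorem dotProduct_inv_distMatrix_mulVec_nonpos {i : Fin n} {x : Fin n × Fin s → ℝ}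
    (hx : (blockSingle n s i)ᵀ *ᵥ x = 0) : x ⬝ᵥ (T.distMatrix hT)⁻¹ *ᵥ x ≤ 0 :=
  dotProduct_inv_mulVec_nonpos_of_transpose_mulVec_eq_zero (distMatrix_isHermitian hT)
    (isUnit_distMatrix hT) (distMatrix_isNegDefOnKer hT) (transpose_blockOnes_mul_blockSingle i)
    (by rw [← blockAt_eq, blockAt_distMatrix, treeDist_self]) hx

theorem dotProduct_perturbedInv_mulVec_nonpos (hβ : 0 ≤ β) {i : Fin n} {x : Fin n × Fin s → ℝ}
    (hx : (blockSingle n s i)ᵀ *ᵥ x = 0) : x ⬝ᵥ perturbedInv hT G β *ᵥ x ≤ 0 := by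
  have hD := dotProduct_inv_distMatrix_mulVec_nonpos hT hx
  have hL := (G.laplacian_posSemidef.smul hβ).dotProduct_mulVec_nonneg x
  rw [star_trivial] at hL
  rw [perturbedInv, Matrix.sub_mulVec, dotProduct_sub]
  linarith

theorem perturbedInv_isNegDefOnKer (hG : G.graph.Preconnected) (hβ : 0 < β) (i : Fin n) :
    IsNegDefOnKer (perturbedInv hT G β) (blockSingle n s i)ᵀ := by
  intro x hx0 hx
  have hD := dotProduct_inv_distMatrix_mulVec_nonpos hT hx
  have hL := mul_pos hβ (dotProduct_laplacian_mulVec_pos hG hx0 hx)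
  rw [perturbedInv, Matrix.sub_mulVec, dotProduct_sub, Matrix.smul_mulVec, dotProduct_smul,
    smul_eq_mul]
  linarith

theorem isUnit_bordered_perturbedInv (hβ : 0 ≤ β) :
    IsUnit (Matrix.fromBlocks (perturbedInv hT G β)⁻¹ (blockOnes n s) (blockOnes n s)ᵀ 0) :=
  isUnit_bordered (isUnit_perturbedInv hT hβ)
    (posDef_transpose_blockOnes_mul_perturbedInv_mul hT).isUnit

theorem numPosEigenvalues_bordered_perturbedInv (hβ : 0 ≤ β) :
    numPosEigenvalues (Matrix.fromBlocks (perturbedInv hT G β)⁻¹ (blockOnes n s)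
      (blockOnes n s)ᵀ 0) = s := by
  rw [numPosEigenvalues_bordered (perturbedInv_isHermitian hT) (isUnit_perturbedInv hT hβ)
    (posDef_transpose_blockOnes_mul_perturbedInv_mul hT),
    numPosEigenvalues_perturbedInv hT hβ]

theorem dotProduct_inv_perturbedInv_mulVec_nonpos (hβ : 0 ≤ β) {x : Fin n × Fin s → ℝ}
    (hx : (blockOnes n s)ᵀ *ᵥ x = 0) : x ⬝ᵥ (perturbedInv hT G β)⁻¹ *ᵥ x ≤ 0 :=
  dotProduct_inv_mulVec_nonpos (perturbedInv_isHermitian hT) (isUnit_perturbedInv hT hβ)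
    (posDef_transpose_blockOnes_mul_perturbedInv_mul hT)
    (by rw [numPosEigenvalues_perturbedInv hT hβ, Fintype.card_fin]) hx

theorem isPosDefForm_blockAt_inv_perturbedInv (hG : G.graph.Preconnected) (hβ : 0 < β)
    (i j : Fin n) : IsPosDefForm (blockAt (perturbedInv hT G β)⁻¹ i j) := by
  have hdiag : ∀ i, ((blockSingle n s i)ᵀ * (perturbedInv hT G β)⁻¹ *
      blockSingle n s i).PosDef := fun i =>
    posDef_transpose_mul_inv_mul_of_isNegDefOnKer (perturbedInv_isHermitian hT)
      (isUnit_perturbedInv hT hβ.le) (posDef_transpose_blockOnes_mul_perturbedInv_mul hT)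
      (transpose_blockOnes_mul_blockSingle i) (perturbedInv_isNegDefOnKer hT hG hβ i)
  rw [blockAt_eq]
  refine isPosDefForm_transpose_mul_mul (perturbedInv_isHermitian hT).inv (hdiag i) (hdiag j)
    fun x => dotProduct_inv_perturbedInv_mulVec_nonpos hT hβ.le ?_
  rw [Matrix.mulVec_sub, Matrix.mulVec_mulVec, Matrix.mulVec_mulVec,
    transpose_blockOnes_mul_blockSingle, transpose_blockOnes_mul_blockSingle, sub_self]

end InvSubLaplacian

end WeightedGraph

theorem theorem2p1 (n s : ℕ) (hn : 2 ≤ n)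
    (T : WeightedGraph n s) (hT : T.graph.IsTree)
    (G : WeightedGraph n s) (hG : G.graph.Connected) :
    IsUnit (T.distMatrix hT) ∧
    (∀ β : ℝ, 0 ≤ β →
      IsUnit ((T.distMatrix hT)⁻¹ - β • G.laplacian) ∧
      ((T.distMatrix hT)⁻¹ - β • G.laplacian).IsSymm ∧
      inertia ((T.distMatrix hT)⁻¹ - β • G.laplacian) = (n * s - s, 0, s) ∧
      (∀ i : Fin n,
        (0 < β →
          (-principalBlocks ((T.distMatrix hT)⁻¹ - β • G.laplacian)
            (Finset.univ \ {i})).PosDef) ∧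
        (-principalBlocks ((T.distMatrix hT)⁻¹ - β • G.laplacian)
          (Finset.univ \ {i})).PosSemidef) ∧
      IsUnit (Matrix.fromBlocks ((T.distMatrix hT)⁻¹ - β • G.laplacian)⁻¹ (blockOnes n s)
        (blockOnes n s)ᵀ 0) ∧
      numPosEigenvalues (Matrix.fromBlocks ((T.distMatrix hT)⁻¹ - β • G.laplacian)⁻¹
        (blockOnes n s) (blockOnes n s)ᵀ 0) = s ∧
      (∀ x : Fin n × Fin s → ℝ, blockJ n s *ᵥ x = 0 →
        x ⬝ᵥ (((T.distMatrix hT)⁻¹ - β • G.laplacian)⁻¹ *ᵥ x) ≤ 0)) ∧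
    (∀ i j : Fin n, IsPosDefForm (blockAt ((T.distMatrix hT)⁻¹ - G.laplacian)⁻¹ i j)) := by
  have := Fin.nontrivial_iff_two_le.2 hn
  have hherm (β : ℝ) := WeightedGraph.perturbedInv_isHermitian hT (G := G) (β := β)
  have hmem (i : Fin n) : i ∉ Finset.univ \ {i} := by simp
  refine ⟨WeightedGraph.isUnit_distMatrix hT, fun β hβ => ⟨?_, ?_, ?_, fun i => ⟨fun hβ' => ?_, ?_⟩,
    ?_, ?_, fun x hx => ?_⟩, fun i j => ?_⟩
  · exact WeightedGraph.isUnit_perturbedInv hT hβ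
  · exact Matrix.isHermitian_iff_isSymm.1 (hherm β)
  · exact WeightedGraph.inertia_perturbedInv hT hβ
  · exact neg_principalBlocks_posDef (hherm β) (hmem i)
      (WeightedGraph.perturbedInv_isNegDefOnKer hT hG.preconnected hβ' i)
  · exact neg_principalBlocks_posSemidef (hherm β) (hmem i) fun _ =>
      WeightedGraph.dotProduct_perturbedInv_mulVec_nonpos hT hβ
  · exact WeightedGraph.isUnit_bordered_perturbedInv hT hβ
  · exact WeightedGraph.numPosEigenvalues_bordered_perturbedInv hT hβ
  · exact WeightedGraph.dotProduct_inv_perturbedInv_mulVec_nonpos hT hβ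
      (transpose_blockOnes_mulVec_eq_zero hx)
  · simpa only [WeightedGraph.perturbedInv, one_smul] using
      WeightedGraph.isPosDefForm_blockAt_inv_perturbedInv hT hG.preconnected one_pos i j
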